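/- **Setting.** For a simple graph $G=(V,E)$ on $V=\{1,\dots,p\}$ and $\theta\in\mathbb R^{\binom p2}$ with $\theta_{st}=0$ for $(s,t)\notin E$, the Ising model is the distribution on $\{-1,+1\}^p$ with $$\mathbb P_{\theta}(x)\propto\exp\Big\{\sum_{(s,t)\in E}\theta_{st}x_sx_t\Big\}.$$ For $\lambda,\omega>0$ let $\Theta_{\lambda,\omega}(G)$ be the set of such $\theta$ with $|\theta_{st}|\ge\lambda$ for all $(s,t)\in E$ and $\sum_{t:(s,t)\in E}|\theta_{st}|\le\omega$ for all $s\in V$. Let $\mathcal G_{p,k}$ be the set of graphs on $p$ vertices with at most $k$ edges ($k\ge1$). A decoder is a map $\phi$ from $n$-tuples of configurations in $\{-1,+1\}^p$ to $\mathcal G_{p,k}$. In the case of known edge weights, an assignment $G\mapsto\theta(G)$ is fixed and $\phi$ may depend on it; given an assignment, $G\in\mathcal G_{p,k}$ is called admissible if $\theta(G)\in\Theta_{\lambda,\omega}(G)$, and the error of $\phi$ at $G$ is the probability $\mathbb P_{\theta(G)}[\phi(X^{(1)},\dots,X^{(n)})\ne G]$ under $n$ i.i.d. samples from $\mathbb P_{\theta(G)}$.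 **Corollary.** Let $0<a\le b$, and consider the scaling $\lambda\asymp k^{-1/2}$, that is, $a\,k^{-1/2}\le\lambda\le b\,k^{-1/2}$. 1. (Sufficiency.) Let the maximum neighborhood weight stay bounded, $0<\omega\le\bar\omega$. There is a constant $c>0$, depending only on $a,b,\bar\omega$, such that in the case of known edge weights some decoder succeeds with high probability using $n>c\,k^2\log p$ samples. Precisely: for every $\delta>0$ there is an $N$, depending only on $\delta,a,b,\bar\omega$, such that for all $n\ge N$ and all $p,k,\lambda,\omega$ as above with $n>c\,k^2\log p$, and for every assignment $G\mapsto\theta(G)$, there is a decoder whose error is at most $\delta$ at every admissible $G\in\mathcal G_{p,k}$. 2. (Within a factor $k$ of the necessary condition.) There are constants $c'>0$ and $p_0$, depending only on $a,b$, such that if $p\ge p_0$, $\lambda\le\omega$ and $n\le c'\max\{k,\lambda^{-2}\}\log p$, then there is an assignment $G\mapsto\theta(G)$ for which every decoder, even one that knows the edge weights, has error at least $1/2$ at some admissible $G\in\mathcal G_{p,k}$. For all constants $c,c'>0$ there is a constant $C>0$, depending only on $c,c',a,b$, such that $c\,k^2\log p\le C\,k\cdot c'\max\{k,\lambda^{-2}\}\log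 p$ throughout the scaling. -/

import Mathlib

namespace IsingSelection

/-- Spin configurations: the set `{-1, +1}^p`. -/
abbrev Config (p : ℕ) : Type := Fin p → ℤˣ

/-- Vectors of edge weights, indexed by unordered pairs of vertices. -/
abbrev Weights (p : ℕ) : Type := Sym2 (Fin p) → ℝ

/-- The product `x_s * x_t` of the spins at the two ends of the pair `e = {s, t}`. -/
def spinProd {p : ℕ} (x : Config p) (e : Sym2 (Fin p)) : ℝ :=
  (((e.map x).mul : ℤˣ) : ℤ)

open Classical in
/-- The exponent `∑_{(s,t) ∈ E} θ_{st} x_s x_t` of the Ising model on `G`. -/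
noncomputable def energy {p : ℕ} (G : SimpleGraph (Fin p)) (θ : Weights p) (x : Config p) : ℝ :=
  ∑ e ∈ G.edgeFinset, θ e * spinProd x e

/-- The normalization factor of the Ising model. -/
noncomputable def partitionFn {p : ℕ} (G : SimpleGraph (Fin p)) (θ : Weights p) : ℝ :=
  ∑ x : Config p, Real.exp (energy G θ x)

/-- The probability mass function of the Ising model on `G` with edge weights `θ`. -/
noncomputable def isingProb {p : ℕ} (G : SimpleGraph (Fin p)) (θ : Weights p) (x : Config p) : ℝ :=
  Real.exp (energy G θ x) / partitionFn G θ

/-- The probability mass function of `n` i.i.d. samples from the Ising model. -/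
noncomputable def sampleProb {p : ℕ} (n : ℕ) (G : SimpleGraph (Fin p)) (θ : Weights p)
    (X : Fin n → Config p) : ℝ :=
  ∏ i, isingProb G θ (X i)

open Classical in
/-- The set `Θ_{lam,om}(G)` of weight vectors that vanish off the edges of `G`, are at least `lam`
in absolute value on every edge, and have total absolute weight at most `om` around every vertex. -/
noncomputable def paramSet {p : ℕ} (lam om : ℝ) (G : SimpleGraph (Fin p)) : Set (Weights p) :=
  {θ | (∀ e, e ∉ G.edgeSet → θ e = 0) ∧
       (∀ e, e ∈ G.edgeSet → lam ≤ |θ e|) ∧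
       (∀ s, ∑ t ∈ G.neighborFinset s, |θ s(s, t)| ≤ om)}

/-- The class of graphs on `p` vertices with at most `k` edges. -/
abbrev GraphClass (p k : ℕ) : Type := {G : SimpleGraph (Fin p) // G.edgeSet.ncard ≤ k}

/-- Graph decoders: maps from `n` samples to the graphs with at most `k` edges. -/
abbrev Decoder (n p k : ℕ) : Type := (Fin n → Config p) → GraphClass p k

open Classical in
/-- The probability that the decoder `φ` does not return `G`, when the data are `n` i.i.d. samples
from the Ising model on `G` with edge weights `θ`. -/
noncomputable def errorProb {n p k : ℕ} (φ : Decoder n p k) (G : GraphClass p k)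
    (θ : Weights p) : ℝ :=
  ∑ X : Fin n → Config p, if φ X ≠ G then sampleProb n G.1 θ X else 0

end IsingSelection

/-! Sufficiency: maximum likelihood over the admissible graphs errs with probability at most a sum
of Bhattacharyya coefficients `∑ √(P Q)`, which become `n`-th powers under i.i.d. sampling. The key
estimate, `sum_sqrt_isingProb_le_of_mem`, keeps each single-sample coefficient below `1` by a
multiple of `lam ^ 2`. If `{s, t}` is an edge of only one graph, flipping the spins at `s` and `t`
and taking the mixed second difference of `log P - log Q` isolates `4 θ_st x_s x_t`. So the
log-ratio is at least `lam` in size at one of four configurations, while a flip changes a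
probability by a factor of at most `exp (2 * om)`. Since `lam ^ 2` has order at least `1 / k` and
there are at most `p ^ (2 * k)` graphs, order `k ^ 2 * log p` samples beat the union bound.

Necessity: take the `p - 1` graphs with one edge at vertex `0`, all of weight `lam`. Each sample law
has second moment at most `exp (n * lam ^ 2)` times that of the uniform law, so by Cauchy–Schwarz an
event of probability above `1 / 2` cannot be small in uniform measure (`exists_half_le_errorProb`).
The decoding regions are disjoint and cannot all be that large. In this scaling `k * lam ^ 2` is
bounded, so `lam ^ (-2)` and the maximum with `k` have the same order. -/

namespace IsingSelection

/-! ### Spins, flips and energy differences. -/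

/-- The real value of a spin. -/
def spin (u : ℤˣ) : ℝ := ((u : ℤ) : ℝ)

lemma spin_mul (u v : ℤˣ) : spin (u * v) = spin u * spin v := by simp [spin]

lemma spin_neg_one : spin (-1) = -1 := by simp [spin]

lemma spin_one : spin 1 = 1 := by simp [spin]

lemma spin_eq_one_or (u : ℤˣ) : spin u = 1 ∨ spin u = -1 := by
  rcases Int.units_eq_one_or u with rfl | rfl
  · exact Or.inl spin_one
  · exact Or.inr spin_neg_one

lemma spinProd_mk {p : ℕ} (x : Config p) (u v : Fin p) :
    spinProd x s(u, v) = spin (x u) * spin (x v) := by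
  rw [← spin_mul]; rfl

lemma spinProd_eq_one_or {p : ℕ} (x : Config p) (e : Sym2 (Fin p)) :
    spinProd x e = 1 ∨ spinProd x e = -1 := spin_eq_one_or _

/-- The configuration whose only negative spin is at `s`; multiplying by it flips the spin at `s`. -/
def flip {p : ℕ} (s : Fin p) : Config p := Pi.mulSingle s (-1)

lemma flip_self {p : ℕ} (s : Fin p) : spin (flip s s) = -1 := by simp [flip, spin]

lemma flip_of_ne {p : ℕ} {s u : Fin p} (h : u ≠ s) : spin (flip s u) = 1 := by
  simp [flip, spin, Pi.mulSingle_eq_of_ne h]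

lemma spinProd_mul_flip_of_notMem {p : ℕ} (x : Config p) {s : Fin p} {e : Sym2 (Fin p)}
    (h : s ∉ e) : spinProd (x * flip s) e = spinProd x e := by
  induction e using Sym2.ind with
  | _ u v =>
    rw [Sym2.mem_iff, not_or] at h
    simp [spinProd_mk, spin_mul, flip_of_ne (Ne.symm h.1), flip_of_ne (Ne.symm h.2)]

lemma spinProd_mixed_diff {p : ℕ} (x : Config p) {s t : Fin p} (hst : s ≠ t)
    {e : Sym2 (Fin p)} (he : ¬ e.IsDiag) :
    spinProd x e + spinProd (x * flip s * flip t) e - spinProd (x * flip s) e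
      - spinProd (x * flip t) e = if e = s(s, t) then 4 * spinProd x s(s, t) else 0 := by
  induction e using Sym2.ind with
  | _ u v =>
    have huv : u ≠ v := by simpa using he
    by_cases hus : u = s <;> by_cases hut : u = t <;> by_cases hvs : v = s <;>
      by_cases hvt : v = t <;> (try subst_vars) <;>
      simp_all [spinProd_mk, spin_mul, flip_self, flip_of_ne, Ne.symm] <;> ring_nf

/-- Only a term that depends on both `x s` and `x t` survives a mixed second difference. If `{s, t}`
is not an edge, both sides vanish. -/
lemma energy_mixed_diff {p : ℕ} (G : SimpleGraph (Fin p)) (θ : Weights p) (x : Config p)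
    {s t : Fin p} (hst : s ≠ t) (hθ : ∀ e, e ∉ G.edgeSet → θ e = 0) :
    energy G θ x + energy G θ (x * flip s * flip t) - energy G θ (x * flip s)
      - energy G θ (x * flip t) = 4 * θ s(s, t) * spinProd x s(s, t) := by
  classical
  unfold energy
  rw [← Finset.sum_add_distrib, ← Finset.sum_sub_distrib, ← Finset.sum_sub_distrib]
  rw [Finset.sum_congr rfl (g := fun e ↦ if e = s(s, t) then 4 * θ s(s, t) * spinProd x s(s, t)
    else 0)]
  · rw [Finset.sum_ite_eq']
    split_ifs with h
    · rfl
    · rw [hθ _ (by simpa using h)]; simp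
  · intro e he
    have h := spinProd_mixed_diff x hst (G.not_isDiag_of_mem_edgeSet (by simpa using he))
    rw [← mul_add, ← mul_sub, ← mul_sub, h]
    split_ifs with h'
    · rw [h']; ring
    · simp

lemma abs_energy_flip_sub_le {p : ℕ} {lam om : ℝ} {G : SimpleGraph (Fin p)} {θ : Weights p}
    (hθ : θ ∈ paramSet lam om G) (x : Config p) (s : Fin p) :
    |energy G θ (x * flip s) - energy G θ x| ≤ 2 * om := by
  classical
  unfold energy
  rw [← Finset.sum_sub_distrib]
  have h1 : ∀ e ∈ G.edgeFinset, |θ e * spinProd (x * flip s) e - θ e * spinProd x e| ≤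
      if s ∈ e then 2 * |θ e| else 0 := by
    intro e _
    split_ifs with h
    · rw [← mul_sub, abs_mul, mul_comm]
      refine mul_le_mul_of_nonneg_right ?_ (abs_nonneg _)
      rcases spinProd_eq_one_or (x * flip s) e with h1 | h1 <;>
        rcases spinProd_eq_one_or x e with h2 | h2 <;> rw [h1, h2] <;> norm_num
    · rw [spinProd_mul_flip_of_notMem x h]; simp
  refine (Finset.abs_sum_le_sum_abs _ _).trans ((Finset.sum_le_sum h1).trans ?_)
  rw [← Finset.sum_filter, ← Finset.mul_sum]
  refine mul_le_mul_of_nonneg_left (le_trans ?_ (hθ.2.2 s)) (by norm_num)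
  have hinj : Set.InjOn (fun t ↦ s(s, t)) (G.neighborFinset s : Set (Fin p)) := by
    intro t _ t' _ h
    exact Sym2.congr_right.1 h
  rw [← Finset.sum_image (f := fun e ↦ |θ e|) (g := fun t ↦ s(s, t)) hinj]
  refine Finset.sum_le_sum_of_subset_of_nonneg ?_ (fun _ _ _ ↦ abs_nonneg _)
  intro e he
  rw [Finset.mem_filter] at he
  obtain ⟨t, rfl⟩ := he.2
  refine Finset.mem_image.2 ⟨t, ?_, rfl⟩
  simpa using he.1

lemma partitionFn_pos {p : ℕ} (G : SimpleGraph (Fin p)) (θ : Weights p) : 0 < partitionFn G θ :=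
  Finset.sum_pos (fun _ _ ↦ Real.exp_pos _) Finset.univ_nonempty

lemma isingProb_pos {p : ℕ} (G : SimpleGraph (Fin p)) (θ : Weights p) (x : Config p) :
    0 < isingProb G θ x := div_pos (Real.exp_pos _) (partitionFn_pos G θ)

lemma sum_isingProb {p : ℕ} (G : SimpleGraph (Fin p)) (θ : Weights p) :
    ∑ x, isingProb G θ x = 1 := by
  simp only [isingProb]
  rw [← Finset.sum_div]
  exact div_self (partitionFn_pos G θ).ne'

lemma sampleProb_pos {p n : ℕ} (G : SimpleGraph (Fin p)) (θ : Weights p) (X : Fin n → Config p) :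
    0 < sampleProb n G θ X := Finset.prod_pos fun _ _ ↦ isingProb_pos _ _ _

lemma sum_sampleProb {p : ℕ} (n : ℕ) (G : SimpleGraph (Fin p)) (θ : Weights p) :
    ∑ X, sampleProb n G θ X = 1 := by
  simp only [sampleProb]
  rw [← Fintype.sum_pow, sum_isingProb, one_pow]

lemma isingProb_le_exp_mul_flip {p : ℕ} {lam om : ℝ} {G : SimpleGraph (Fin p)} {θ : Weights p}
    (hθ : θ ∈ paramSet lam om G) (x : Config p) (s : Fin p) :
    Real.exp (-(2 * om)) * isingProb G θ x ≤ isingProb G θ (x * flip s) := by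
  unfold isingProb
  rw [← mul_div_assoc, ← Real.exp_add]
  refine div_le_div_of_nonneg_right (Real.exp_le_exp.2 ?_) (partitionFn_pos G θ).le
  linarith [(abs_le.1 (abs_energy_flip_sub_le hθ x s)).1]

lemma log_isingProb {p : ℕ} (G : SimpleGraph (Fin p)) (θ : Weights p) (x : Config p) :
    Real.log (isingProb G θ x) = energy G θ x - Real.log (partitionFn G θ) := by
  rw [isingProb, Real.log_div (Real.exp_pos _).ne' (partitionFn_pos G θ).ne', Real.log_exp]

/-! ### Hellinger separation of two Ising models. -/

/-- With `u` half the log-ratio, the right side is `Q * (exp u - 1) ^ 2`. The factor `exp (-b)` is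
needed only for negative `u`, where `1 - exp (-(l / 2)) ≥ exp (-(l / 2)) * (l / 2)`. -/
lemma mul_sq_le_sq_sqrt_sub_sqrt {P Q l b : ℝ} (hP : 0 < P) (hQ : 0 < Q) (hl : 0 ≤ l)
    (hlb : l ≤ b) (h : l ≤ |Real.log P - Real.log Q|) :
    Real.exp (-b) * (l ^ 2 / 4) * Q ≤ (√P - √Q) ^ 2 := by
  set u := (Real.log P - Real.log Q) / 2 with hu
  have hsq : √P = Real.exp u * √Q := by
    have hP' : √P = Real.exp (Real.log P / 2) := by
      rw [← Real.log_sqrt hP.le, Real.exp_log (Real.sqrt_pos.2 hP)]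
    have hQ' : √Q = Real.exp (Real.log Q / 2) := by
      rw [← Real.log_sqrt hQ.le, Real.exp_log (Real.sqrt_pos.2 hQ)]
    rw [hP', hQ', ← Real.exp_add]
    congr 1
    rw [hu]; ring
  have hexp : Real.exp (-b / 2) * (l / 2) ≤ |Real.exp u - 1| := by
    rcases le_abs.1 h with h | h
    · have h1 : l / 2 ≤ Real.exp u - 1 := by linarith [Real.add_one_le_exp u]
      have h2 : Real.exp (-b / 2) ≤ 1 := Real.exp_le_one_iff.2 (by linarith)
      exact le_trans (by nlinarith) (h1.trans (le_abs_self _))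
    · have h1 : Real.exp u ≤ Real.exp (-(l / 2)) := Real.exp_le_exp.2 (by linarith)
      have h2 : Real.exp (-b / 2) ≤ Real.exp (-(l / 2)) := Real.exp_le_exp.2 (by linarith)
      have h3 : Real.exp (-(l / 2)) * Real.exp (l / 2) = 1 := by
        rw [← Real.exp_add]; simp
      have h4 := Real.add_one_le_exp (l / 2)
      have h5 := Real.exp_pos (-(l / 2))
      refine le_trans ?_ (neg_le_abs _)
      nlinarith
  have hb : Real.exp (-b) = Real.exp (-b / 2) ^ 2 := by
    rw [← Real.exp_nat_mul]; congr 1; push_cast; ring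
  calc Real.exp (-b) * (l ^ 2 / 4) * Q = (Real.exp (-b / 2) * (l / 2)) ^ 2 * Q := by rw [hb]; ring
    _ ≤ |Real.exp u - 1| ^ 2 * Q := by gcongr
    _ = (√P - √Q) ^ 2 := by
      rw [hsq, sq_abs]
      nth_rewrite 1 [← Real.sq_sqrt hQ.le]
      ring

lemma sum_sqrt_isingProb_le_of_mem {p : ℕ} {lam om b : ℝ} (hl : 0 ≤ lam) (hlb : lam ≤ b)
    (hom : 0 ≤ om)
    {G G' : SimpleGraph (Fin p)} {θ θ' : Weights p} (hθ : θ ∈ paramSet lam om G)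
    (hθ' : θ' ∈ paramSet lam om G') {s t : Fin p} (h : G.Adj s t) (h' : ¬ G'.Adj s t) :
    ∑ x, √(isingProb G θ x * isingProb G' θ' x) ≤
      1 - Real.exp (-(4 * om + b)) * lam ^ 2 / 32 := by
  classical
  set P := isingProb G θ
  set Q := isingProb G' θ'
  set H : Config p → ℝ := fun x ↦ (√(P x) - √(Q x)) ^ 2 with hH
  have hH0 : ∀ x, 0 ≤ H x := fun x ↦ sq_nonneg _
  have hsum : ∑ x, H x = 2 - 2 * ∑ x, √(P x * Q x) := by
    have : ∀ x, H x = P x + Q x - 2 * √(P x * Q x) := fun x ↦ by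
      simp only [hH]
      rw [Real.sqrt_mul (isingProb_pos _ _ _).le, sub_sq, Real.sq_sqrt (isingProb_pos _ _ _).le,
        Real.sq_sqrt (isingProb_pos _ _ _).le]
      ring
    rw [Finset.sum_congr rfl fun x _ ↦ this x, Finset.sum_sub_distrib, Finset.sum_add_distrib,
      sum_isingProb, sum_isingProb, Finset.mul_sum]
    norm_num
  have hshift : ∀ g : Config p, ∑ x, H (x * g) = ∑ x, H x := fun g ↦
    Equiv.sum_comp (Equiv.mulRight g) H
  set κ := Real.exp (-(4 * om + b)) * (lam ^ 2 / 4) with hκ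
  have hκ' : ∀ y x, Real.exp (-(4 * om)) * Q x ≤ Q y →
      lam ≤ |Real.log (P y) - Real.log (Q y)| → κ * Q x ≤ H y := by
    intro y x hyx hy
    refine le_trans ?_ (mul_sq_le_sq_sqrt_sub_sqrt (isingProb_pos _ _ _) (isingProb_pos _ _ _)
      hl hlb hy)
    have : Real.exp (-(4 * om + b)) = Real.exp (-b) * Real.exp (-(4 * om)) := by
      rw [← Real.exp_add]; congr 1; ring
    rw [hκ, this]
    calc _ = Real.exp (-b) * (lam ^ 2 / 4) * (Real.exp (-(4 * om)) * Q x) := by ring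
      _ ≤ _ := by gcongr
  have hflip : ∀ x s, Real.exp (-(2 * om)) * Q x ≤ Q (x * flip s) :=
    isingProb_le_exp_mul_flip hθ'
  have hle : Real.exp (-(4 * om)) ≤ Real.exp (-(2 * om)) := Real.exp_le_exp.2 (by linarith)
  have hsq : Real.exp (-(4 * om)) = Real.exp (-(2 * om)) * Real.exp (-(2 * om)) := by
    rw [← Real.exp_add]; congr 1; ring
  -- Summed over `x`, each of the four terms on the right gives the full sum of `H`, because flips
  -- permute the configurations. Hence `κ ≤ 4 * ∑ H`, and the coefficient is at most `1 - κ / 8`.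
  have hpoint : ∀ x, κ * Q x ≤
      H x + H (x * flip s * flip t) + H (x * flip s) + H (x * flip t) := by
    intro x
    have hQ : 0 < Q x := isingProb_pos _ _ _
    have e1 := energy_mixed_diff G θ x h.ne hθ.1
    have e2 := energy_mixed_diff G' θ' x h.ne hθ'.1
    rw [hθ'.1 s(s, t) (by simpa using h')] at e2
    have hlam : lam ≤ |θ s(s, t) * spinProd x s(s, t)| := by
      rw [abs_mul]
      have := hθ.2.1 s(s, t) (by simpa using h)
      rcases spinProd_eq_one_or x s(s, t) with h1 | h1 <;> simpa [h1] using this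
    -- The log partition functions cancel in the alternating sum of these four log-ratios, which has
    -- absolute value at least `4 * lam`.
    have hfour : lam ≤ |Real.log (P x) - Real.log (Q x)| ∨
        lam ≤ |Real.log (P (x * flip s * flip t)) - Real.log (Q (x * flip s * flip t))| ∨
        lam ≤ |Real.log (P (x * flip s)) - Real.log (Q (x * flip s))| ∨
        lam ≤ |Real.log (P (x * flip t)) - Real.log (Q (x * flip t))| := by
      by_contra! hc
      simp only [P, Q, log_isingProb] at hc
      obtain ⟨c1, c2, c3, c4⟩ := hc
      rw [abs_lt] at c1 c2 c3 c4
      rcases le_abs.1 hlam with hlam | hlam <;> linarith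
    have n1 := hH0 x
    have n2 := hH0 (x * flip s * flip t)
    have n3 := hH0 (x * flip s)
    have n4 := hH0 (x * flip t)
    rcases hfour with h1 | h1 | h1 | h1
    · have : Real.exp (-(4 * om)) ≤ 1 := Real.exp_le_one_iff.2 (by linarith)
      linarith [hκ' _ x (by nlinarith) h1]
    · have := hκ' _ x (by
        rw [hsq, mul_assoc]
        exact (mul_le_mul_of_nonneg_left (hflip x s) (Real.exp_pos _).le).trans (hflip _ t)) h1
      linarith
    · linarith [hκ' _ x ((mul_le_mul_of_nonneg_right hle hQ.le).trans (hflip x s)) h1]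
    · linarith [hκ' _ x ((mul_le_mul_of_nonneg_right hle hQ.le).trans (hflip x t)) h1]
  have htot := Finset.sum_le_sum fun x (_ : x ∈ Finset.univ) ↦ hpoint x
  rw [← Finset.mul_sum, sum_isingProb, Finset.sum_add_distrib, Finset.sum_add_distrib,
    Finset.sum_add_distrib, hshift, hshift] at htot
  have hshift' : ∑ x, H (x * flip s * flip t) = ∑ x, H x := by
    simp_rw [mul_assoc]
    exact hshift _
  linarith

lemma sum_sqrt_isingProb_le {p : ℕ} {lam om b : ℝ} (hl : 0 ≤ lam) (hlb : lam ≤ b) (hom : 0 ≤ om)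
    {G G' : SimpleGraph (Fin p)} {θ θ' : Weights p} (hθ : θ ∈ paramSet lam om G)
    (hθ' : θ' ∈ paramSet lam om G') (h : G ≠ G') :
    ∑ x, √(isingProb G θ x * isingProb G' θ' x) ≤
      1 - Real.exp (-(4 * om + b)) * lam ^ 2 / 32 := by
  have : ∃ s t, ¬ (G.Adj s t ↔ G'.Adj s t) := by
    by_contra! hc
    exact h (by ext s t; exact hc s t)
  obtain ⟨s, t, hst⟩ := this
  by_cases h1 : G.Adj s t
  · exact sum_sqrt_isingProb_le_of_mem hl hlb hom hθ hθ' h1 (by tauto)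
  · simp_rw [mul_comm (isingProb G θ _)]
    exact sum_sqrt_isingProb_le_of_mem hl hlb hom hθ' hθ (s := s) (t := t) (by tauto) h1

/-! ### Maximum likelihood and the union bound. -/

lemma sum_sqrt_sampleProb {p : ℕ} (n : ℕ) (G G' : SimpleGraph (Fin p)) (θ θ' : Weights p) :
    ∑ X, √(sampleProb n G θ X * sampleProb n G' θ' X) =
      (∑ x, √(isingProb G θ x * isingProb G' θ' x)) ^ n := by
  rw [Fintype.sum_pow]
  refine Finset.sum_congr rfl fun X _ ↦ ?_
  rw [sampleProb, sampleProb, ← Finset.prod_mul_distrib, Real.sqrt_eq_iff_mul_self_eq,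
    ← Finset.prod_mul_distrib]
  · exact Finset.prod_congr rfl fun i _ ↦
      (Real.mul_self_sqrt (mul_pos (isingProb_pos _ _ _) (isingProb_pos _ _ _)).le).symm
  · exact Finset.prod_nonneg fun i _ ↦ (mul_pos (isingProb_pos _ _ _) (isingProb_pos _ _ _)).le
  · exact Finset.prod_nonneg fun i _ ↦ Real.sqrt_nonneg _

/-- Maximum likelihood: the error is at most a sum of Bhattacharyya coefficients. -/
lemma exists_maximum_likelihood {ι Ω : Type*} [Fintype Ω] [Nonempty ι]
    [DecidableEq ι] (S : Finset ι)
    (P : ι → Ω → ℝ) (hP : ∀ i y, 0 ≤ P i y) :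
    ∃ φ : Ω → ι, ∀ i ∈ S, (∑ y, if φ y ≠ i then P i y else 0) ≤
      ∑ j ∈ S.erase i, ∑ y, √(P i y * P j y) := by
  rcases S.eq_empty_or_nonempty with rfl | hS
  · exact ⟨fun _ ↦ Classical.arbitrary ι, by simp⟩
  choose φ hφ hmax using fun y ↦ S.exists_max_image (fun i ↦ P i y) hS
  refine ⟨φ, fun i hi ↦ ?_⟩
  rw [Finset.sum_comm]
  refine Finset.sum_le_sum fun y _ ↦ ?_
  split_ifs with h
  -- On an error, the chosen index is one of the summands and its likelihood is at least that of
  -- `i`.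
  · calc P i y ≤ √(P i y * P (φ y) y) :=
        Real.le_sqrt_of_sq_le (by
          rw [sq]; exact mul_le_mul_of_nonneg_left (hmax y i hi) (hP i y))
      _ ≤ _ := Finset.single_le_sum (f := fun j ↦ √(P i y * P j y))
        (fun _ _ ↦ Real.sqrt_nonneg _) (Finset.mem_erase.2 ⟨h, hφ y⟩)
  · exact Finset.sum_nonneg fun _ _ ↦ Real.sqrt_nonneg _

lemma card_graphClass_le {p : ℕ} (hp : 0 < p) (k : ℕ) : Nat.card (GraphClass p k) ≤ p ^ (2 * k) := by
  classical
  let F : (Fin k → Fin p × Fin p) → SimpleGraph (Fin p) := fun f ↦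
    SimpleGraph.fromEdgeSet (Set.range fun i ↦ s((f i).1, (f i).2))
  have hF : ∀ G : GraphClass p k, ∃ f, F f = G.1 := by
    intro G
    -- Short edge lists are padded to length `k` with a loop, which `fromEdgeSet` discards.
    let d : Sym2 (Fin p) := s(⟨0, hp⟩, ⟨0, hp⟩)
    let l := G.1.edgeFinset.toList
    have hl : l.length ≤ k := by
      have h := G.2
      rw [Set.ncard_eq_toFinset_card'] at h
      rw [Finset.length_toList]
      convert h using 2
      ext e; simp
    let g : Fin k → Sym2 (Fin p) := fun i ↦ l.getD i d
    refine ⟨fun i ↦ (g i).out, ?_⟩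
    have hg : ∀ i, s(((g i).out).1, ((g i).out).2) = g i := fun i ↦ Quot.out_eq (g i)
    ext u v
    simp only [F, hg, SimpleGraph.fromEdgeSet_adj, Set.mem_range]
    constructor
    · rintro ⟨⟨i, hi⟩, huv⟩
      by_cases hlt : (i : ℕ) < l.length
      · have : g i ∈ l := by
          simp only [g]
          rw [List.getD_eq_getElem _ _ hlt]
          exact List.getElem_mem hlt
        rw [hi] at this
        simpa [l] using this
      · have : g i = d := List.getD_eq_default _ _ (not_lt.1 hlt)
        rw [hi] at this
        exfalso
        apply huv
        simp only [d, Sym2.eq_iff] at this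
        rcases this with h | h <;> rw [h.1, h.2]
    · intro h
      refine ⟨?_, h.ne⟩
      have : s(u, v) ∈ l := by simpa [l] using h
      obtain ⟨i, hi, hi'⟩ := List.getElem_of_mem this
      exact ⟨⟨i, hi.trans_le hl⟩, by simp only [g]; rw [List.getD_eq_getElem _ _ hi, hi']⟩
  choose f hf using hF
  have hinj : Function.Injective f := fun G G' h ↦ Subtype.ext (by rw [← hf G, ← hf G', h])
  calc Nat.card (GraphClass p k) ≤ Nat.card (Fin k → Fin p × Fin p) :=
        Nat.card_le_card_of_injective f hinj
    _ = p ^ (2 * k) := by simp [pow_mul, sq]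

open Classical in
lemma exists_decoder_errorProb_le {n p k : ℕ} {lam om b : ℝ} (hl : 0 ≤ lam) (hlb : lam ≤ b)
    (hom : 0 ≤ om) (hp : 0 < p) (θ : SimpleGraph (Fin p) → Weights p) :
    ∃ φ : Decoder n p k, ∀ G : GraphClass p k, θ G.1 ∈ paramSet lam om G.1 →
      errorProb φ G (θ G.1) ≤
        (p : ℝ) ^ (2 * k) * Real.exp (-(n * (Real.exp (-(4 * om + b)) * lam ^ 2 / 32))) := by
  have : Nonempty (GraphClass p k) := ⟨⟨⊥, by simp⟩⟩
  obtain ⟨φ, hφ⟩ := exists_maximum_likelihood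
    (Finset.univ.filter fun G : GraphClass p k ↦ θ G.1 ∈ paramSet lam om G.1)
    (fun G ↦ sampleProb n G.1 (θ G.1)) (fun _ _ ↦ (sampleProb_pos _ _ _).le)
  refine ⟨φ, fun G hG ↦ (hφ G (by simpa using hG)).trans ?_⟩
  set ε := Real.exp (-(4 * om + b)) * lam ^ 2 / 32
  refine (Finset.sum_le_card_nsmul _ _ (Real.exp (-(n * ε))) ?_).trans ?_
  · intro G' hG'
    rw [Finset.mem_erase, Finset.mem_filter] at hG'
    rw [sum_sqrt_sampleProb]
    have h := sum_sqrt_isingProb_le hl hlb hom hG hG'.2.2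
      (fun h ↦ hG'.1 (Subtype.ext h.symm))
    calc _ ≤ (Real.exp (-ε)) ^ n := by
          refine pow_le_pow_left₀ (Finset.sum_nonneg fun _ _ ↦ Real.sqrt_nonneg _) ?_ n
          exact h.trans (by simpa [ε, neg_add_eq_sub] using Real.add_one_le_exp (-ε))
      _ = _ := by rw [← Real.exp_nat_mul]; congr 1; ring
  · rw [nsmul_eq_mul]
    refine mul_le_mul_of_nonneg_right ?_ (Real.exp_pos _).le
    have h1 := card_graphClass_le hp k
    rw [Nat.card_eq_fintype_card] at h1
    have h2 := ((Finset.univ.filter fun G : GraphClass p k ↦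
      θ G.1 ∈ paramSet lam om G.1).erase G).card_le_univ
    exact_mod_cast h2.trans h1

lemma errorProb_eq_zero_of_subsingleton {n p k : ℕ} (hp : p ≤ 1) (φ : Decoder n p k)
    (G : GraphClass p k) (θ : Weights p) : errorProb φ G θ = 0 := by
  have : Subsingleton (Fin p) := Fin.subsingleton_iff_le_one.2 hp
  refine Finset.sum_eq_zero fun X _ ↦ if_neg (not_not.2 ?_)
  refine Subtype.ext ?_
  ext u v
  rw [Subsingleton.elim v u]
  simp

/-- The sample size of order `k ^ 2 * log p` is sufficient. -/
theorem sufficiency (a b omMax : ℝ) (ha : 0 < a) :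
    ∃ c : ℝ, 0 < c ∧ ∀ δ : ℝ, 0 < δ → ∃ N : ℕ,
      ∀ (n p k : ℕ) (lam om : ℝ), N ≤ n → 1 ≤ k →
        a / Real.sqrt k ≤ lam → lam ≤ b / Real.sqrt k → 0 < om → om ≤ omMax →
        c * (k : ℝ) ^ 2 * Real.log p < n →
        ∀ θ : SimpleGraph (Fin p) → Weights p,
          ∃ φ : Decoder n p k, ∀ G : GraphClass p k, θ G.1 ∈ paramSet lam om G.1 →
            errorProb φ G (θ G.1) ≤ δ := by
  set ε := Real.exp (-(4 * omMax + b)) * a ^ 2 / 32 with hε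
  have hε0 : 0 < ε := by positivity
  -- The exponent `n * ε / k` is split into two halves `E`: one absorbs the graph count `p ^ (2 *
  -- k)`, the other is at least `-log δ`. The constant `4 / ε` makes `E` exceed `2 * k * log p`.
  refine ⟨4 / ε, by positivity, fun δ hδ ↦ ?_⟩
  have hlog2 : 0 < Real.log 2 := Real.log_pos (by norm_num)
  obtain ⟨N, hN⟩ := exists_nat_ge ((Real.log δ) ^ 2 / (ε * Real.log 2))
  refine ⟨N, fun n p k lam om hn hk hal hlb hom homM hlt θ ↦ ?_⟩
  have : Nonempty (GraphClass p k) := ⟨⟨⊥, by simp⟩⟩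
  -- Here `log p = 0`, so the sample bound says nothing, but there is only one graph.
  rcases le_or_gt p 1 with hp | hp
  · exact ⟨Classical.arbitrary _, fun G _ ↦ by
      rw [errorProb_eq_zero_of_subsingleton hp]; exact hδ.le⟩
  have hk1 : (1 : ℝ) ≤ k := by exact_mod_cast hk
  have hk0 : (0 : ℝ) < k := by linarith
  have hs0 : 0 < √(k : ℝ) := Real.sqrt_pos.2 hk0
  have hs1 : 1 ≤ √(k : ℝ) := Real.one_le_sqrt.2 hk1
  have hl0 : 0 < lam := lt_of_lt_of_le (by positivity) hal
  have hb : 0 < b := by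
    have := hl0.trans_le hlb
    rwa [lt_div_iff₀ hs0, zero_mul] at this
  have hlb' : lam ≤ b := hlb.trans (div_le_self hb.le hs1)
  have hlsq : a ^ 2 / k ≤ lam ^ 2 := by
    have := pow_le_pow_left₀ (by positivity) hal 2
    rwa [div_pow, Real.sq_sqrt hk0.le] at this
  have hεk : ε / k ≤ Real.exp (-(4 * om + b)) * lam ^ 2 / 32 := by
    have : Real.exp (-(4 * omMax + b)) ≤ Real.exp (-(4 * om + b)) :=
      Real.exp_le_exp.2 (by linarith)
    calc ε / k = Real.exp (-(4 * omMax + b)) * (a ^ 2 / k) / 32 := by rw [hε]; ring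
      _ ≤ _ := by gcongr
  obtain ⟨φ, hφ⟩ := exists_decoder_errorProb_le (n := n) (k := k) hl0.le hlb' hom.le
    (by omega : 0 < p) θ
  refine ⟨φ, fun G hG ↦ (hφ G hG).trans ?_⟩
  have hp0 : (0 : ℝ) < p := by exact_mod_cast (by omega : 0 < p)
  have hlogp : Real.log 2 ≤ Real.log p :=
    Real.log_le_log (by norm_num) (by exact_mod_cast hp)
  set E := n * ε / (2 * k) with hE
  have hE1 : 2 * k * Real.log p < E := by
    rw [hE, lt_div_iff₀ (by positivity)]
    calc 2 * k * Real.log p * (2 * k) = ε * (4 / ε * k ^ 2 * Real.log p) := by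
          field_simp; ring
      _ < ε * n := by gcongr
      _ = n * ε := mul_comm _ _
  have hE0 : 0 < E := lt_trans (by have := hlog2.trans_le hlogp; positivity) hE1
  have hEsq : Real.log δ ^ 2 ≤ E ^ 2 := by
    have h1 : Real.log δ ^ 2 ≤ n * (ε * Real.log 2) := by
      rw [div_le_iff₀ (by positivity)] at hN
      exact hN.trans (by gcongr)
    -- Bounding one factor of `E * E` by this cancels the `k` in `E`, so `N` need not depend on `p`
    -- or `k`.
    have h2 : 2 * k * Real.log 2 ≤ E := le_trans (by gcongr) hE1.le
    calc _ ≤ n * (ε * Real.log 2) := h1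
      _ = E * (2 * k * Real.log 2) := by rw [hE]; field_simp
      _ ≤ E * E := by gcongr
      _ = E ^ 2 := (sq E).symm
  have hδE : -E ≤ Real.log δ := (abs_le_of_sq_le_sq' hEsq hE0.le).1
  have hpow : (p : ℝ) ^ (2 * k) = Real.exp (2 * k * Real.log p) := by
    rw [← Real.exp_log hp0, ← Real.exp_nat_mul, Real.exp_log hp0]; push_cast; rfl
  rw [hpow, ← Real.exp_add, ← Real.le_log_iff_exp_le hδ]
  have : n * (ε / k) = 2 * E := by rw [hE]; field_simp
  have h3 : n * (ε / k) ≤ n * (Real.exp (-(4 * om + b)) * lam ^ 2 / 32) := by gcongr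
  linarith

/-! ### Lower bound from single-edge graphs. -/

/-- The weight vector which takes the constant value `lam` on the edges of `G`. -/
noncomputable def constWeights {p : ℕ} (lam : ℝ) (G : SimpleGraph (Fin p)) : Weights p :=
  G.edgeSet.indicator fun _ ↦ lam

lemma constWeights_edge_mem_paramSet {p : ℕ} {lam om : ℝ} (hl : 0 ≤ lam) (hlo : lam ≤ om)
    {s t : Fin p} (hst : s ≠ t) :
    constWeights lam (SimpleGraph.edge s t) ∈ paramSet lam om (SimpleGraph.edge s t) := by
  classical
  refine ⟨fun e he ↦ Set.indicator_of_notMem he _, fun e he ↦ ?_, fun u ↦ ?_⟩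
  · rw [constWeights, Set.indicator_of_mem he, abs_of_nonneg hl]
  · obtain ⟨v, hv⟩ : ∃ v, ∀ w, (SimpleGraph.edge s t).Adj u w → w = v := by
      refine ⟨if u = s then t else s, fun w hw ↦ ?_⟩
      rw [SimpleGraph.edge_adj] at hw
      split_ifs <;> grind
    refine (Finset.sum_le_sum_of_subset_of_nonneg (t := {v}) (fun w hw ↦ Finset.mem_singleton.2
      (hv w (Set.mem_toFinset.1 hw))) fun _ _ _ ↦ abs_nonneg _).trans ?_
    rw [Finset.sum_singleton, constWeights]
    refine le_trans ?_ hlo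
    by_cases h : s(u, v) ∈ (SimpleGraph.edge s t).edgeSet
    · rw [Set.indicator_of_mem h, abs_of_nonneg hl]
    · rw [Set.indicator_of_notMem h, abs_zero]; exact hl

lemma energy_edge {p : ℕ} (lam : ℝ) {s t : Fin p} (hst : s ≠ t) (x : Config p) :
    energy (SimpleGraph.edge s t) (constWeights lam (SimpleGraph.edge s t)) x =
      lam * spinProd x s(s, t) := by
  classical
  have h : (SimpleGraph.edge s t).edgeSet = {s(s, t)} := SimpleGraph.edgeSet_edge_of_ne hst
  have h' : (SimpleGraph.edge s t).edgeFinset = {s(s, t)} := by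
    ext e; simp [h]
  unfold energy constWeights
  rw [Finset.sum_congr (s₂ := {s(s, t)}) (by convert h') fun _ _ ↦ rfl, Finset.sum_singleton,
    Set.indicator_of_mem (by rw [h]; rfl)]

/-- Flipping the spin at `s` reverses the sign of the product, so the sum can be averaged with its
reflection. -/
lemma sum_exp_mul_spinProd {p : ℕ} (lam : ℝ) {s t : Fin p} (hst : s ≠ t) :
    ∑ x : Config p, Real.exp (lam * spinProd x s(s, t)) =
      Fintype.card (Config p) * Real.cosh lam := by
  have h := Equiv.sum_comp (Equiv.mulRight (flip s))
    fun x : Config p ↦ Real.exp (lam * spinProd x s(s, t))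
  have hflip : ∀ x : Config p, spinProd (x * flip s) s(s, t) = - spinProd x s(s, t) := fun x ↦ by
    simp [spinProd_mk, spin_mul, flip_self, flip_of_ne hst.symm]
  simp only [Equiv.coe_mulRight, hflip] at h
  have h2 : ∑ x : Config p, (Real.exp (lam * spinProd x s(s, t)) +
      Real.exp (lam * -spinProd x s(s, t))) = ∑ _x : Config p, 2 * Real.cosh lam := by
    refine Finset.sum_congr rfl fun x _ ↦ ?_
    rw [Real.cosh_eq]
    rcases spinProd_eq_one_or x s(s, t) with h1 | h1 <;> rw [h1] <;> ring_nf
  rw [Finset.sum_add_distrib, h, Finset.sum_const, nsmul_eq_mul, Finset.card_univ] at h2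
  linarith

/-- With `C = cosh x ^ 2`, the numerator is `2 * C - 1 ≤ C ^ 2`, and `C ≤ exp (x ^ 2)`. -/
lemma cosh_two_mul_div_le (x : ℝ) : Real.cosh (2 * x) / Real.cosh x ^ 2 ≤ Real.exp (x ^ 2) := by
  have hc : 0 < Real.cosh x ^ 2 := pow_pos (Real.cosh_pos x) 2
  have h1 : Real.cosh x ^ 2 ≤ Real.exp (x ^ 2) := by
    calc Real.cosh x ^ 2 ≤ Real.exp (x ^ 2 / 2) ^ 2 :=
          pow_le_pow_left₀ (Real.cosh_pos x).le (Real.cosh_le_exp_half_sq x) 2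
      _ = Real.exp (x ^ 2) := by rw [← Real.exp_nat_mul]; congr 1; push_cast; ring
  rw [div_le_iff₀ hc, Real.cosh_two_mul, Real.sinh_sq]
  have h2 := Real.one_le_cosh x
  have h3 : 1 ≤ Real.cosh x ^ 2 := by nlinarith
  nlinarith

lemma sum_sq_isingProb_edge_le {p : ℕ} (lam : ℝ) {s t : Fin p} (hst : s ≠ t) :
    ∑ x, isingProb (SimpleGraph.edge s t) (constWeights lam (SimpleGraph.edge s t)) x ^ 2 ≤
      Real.exp (lam ^ 2) / Fintype.card (Config p) := by
  have hM : (0 : ℝ) < Fintype.card (Config p) := by exact_mod_cast Fintype.card_pos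
  have hsq : ∀ y : ℝ, Real.exp (lam * y) ^ 2 = Real.exp (2 * lam * y) := fun y ↦ by
    rw [← Real.exp_nat_mul]; congr 1; push_cast; ring
  simp only [isingProb, partitionFn, energy_edge lam hst, div_pow, hsq]
  rw [← Finset.sum_div, sum_exp_mul_spinProd _ hst, sum_exp_mul_spinProd _ hst]
  calc _ = Real.cosh (2 * lam) / Real.cosh lam ^ 2 / Fintype.card (Config p) := by
        have := Real.cosh_pos lam
        field_simp
    _ ≤ _ := by gcongr; exact cosh_two_mul_div_le lam

lemma sum_sq_sampleProb_edge_le {p : ℕ} (n : ℕ) (lam : ℝ) {s t : Fin p} (hst : s ≠ t) :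
    ∑ X, sampleProb n (SimpleGraph.edge s t) (constWeights lam (SimpleGraph.edge s t)) X ^ 2 ≤
      Real.exp (n * lam ^ 2) / Fintype.card (Fin n → Config p) := by
  simp only [sampleProb, ← Finset.prod_pow]
  rw [← Fintype.sum_pow (fun x ↦
    isingProb (SimpleGraph.edge s t) (constWeights lam (SimpleGraph.edge s t)) x ^ 2),
    Fintype.card_fun, Fintype.card_fin, Nat.cast_pow, Real.exp_nat_mul,
    ← div_pow]
  exact pow_le_pow_left₀ (Finset.sum_nonneg fun _ _ ↦ sq_nonneg _)
    (sum_sq_isingProb_edge_le lam hst) n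

open Classical in
lemma one_sub_errorProb {n p k : ℕ} (φ : Decoder n p k) (G : GraphClass p k) (θ : Weights p) :
    1 - errorProb φ G θ = ∑ X ∈ Finset.univ.filter (fun X ↦ φ X = G), sampleProb n G.1 θ X := by
  rw [← sum_sampleProb n G.1 θ, errorProb, ← Finset.sum_sub_distrib, Finset.sum_filter]
  refine Finset.sum_congr rfl fun X _ ↦ ?_
  by_cases h : φ X = G <;> simp [h]

/-- Among the graphs with the single edge `{0, i}`, some graph is missed with probability at least
one half. -/
lemma exists_half_le_errorProb {n m k : ℕ} (hk : 1 ≤ k) {lam : ℝ} (hm : 0 < m)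
    (hn : 4 * Real.exp (n * lam ^ 2) ≤ m) (φ : Decoder n (m + 1) k) :
    ∃ (i : Fin m) (h : (SimpleGraph.edge 0 i.succ).edgeSet.ncard ≤ k),
      1 / 2 ≤ errorProb φ ⟨SimpleGraph.edge 0 i.succ, h⟩
        (constWeights lam (SimpleGraph.edge 0 i.succ)) := by
  classical
  have hne : ∀ i : Fin m, (0 : Fin (m + 1)) ≠ i.succ := fun i ↦ (Fin.succ_ne_zero i).symm
  have hcard : ∀ i : Fin m, (SimpleGraph.edge 0 i.succ).edgeSet.ncard ≤ k := fun i ↦ by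
    rw [SimpleGraph.edgeSet_edge_of_ne (hne i), Set.ncard_singleton]; exact hk
  let g : Fin m → GraphClass (m + 1) k := fun i ↦ ⟨SimpleGraph.edge 0 i.succ, hcard i⟩
  have hg : Function.Injective g := by
    intro i j h
    have h1 : (SimpleGraph.edge 0 i.succ).edgeSet = (SimpleGraph.edge 0 j.succ).edgeSet :=
      congrArg (fun G : GraphClass (m + 1) k ↦ G.1.edgeSet) h
    rw [SimpleGraph.edgeSet_edge_of_ne (hne i), SimpleGraph.edgeSet_edge_of_ne (hne j),
      Set.singleton_eq_singleton_iff, Sym2.congr_right] at h1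
    exact Fin.succ_injective _ h1
  let A : Fin m → Finset (Fin n → Config (m + 1)) := fun i ↦ Finset.univ.filter fun X ↦ φ X = g i
  set M : ℝ := (Fintype.card (Fin n → Config (m + 1)) : ℝ) with hM
  have hM0 : 0 < M := by rw [hM]; exact_mod_cast Fintype.card_pos
  have hA : ∑ i, ((A i).card : ℝ) ≤ M := by
    rw [hM]
    have hdisj : (Set.univ : Set (Fin m)).PairwiseDisjoint A := by
      intro i _ j _ hij
      refine Finset.disjoint_left.2 fun X hi hj ↦ hij (hg ?_)
      rw [← (Finset.mem_filter.1 hi).2, ← (Finset.mem_filter.1 hj).2]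
    have := (Finset.univ.biUnion A).card_le_univ
    rw [Finset.card_biUnion fun i _ j _ hij ↦ hdisj trivial trivial hij] at this
    exact_mod_cast this
  by_contra! hc
  have hbig : ∀ i, M / m < (A i).card := by
    intro i
    have h1 : 1 / 2 < ∑ X ∈ A i, sampleProb n (SimpleGraph.edge 0 i.succ)
        (constWeights lam (SimpleGraph.edge 0 i.succ)) X := by
      have h := one_sub_errorProb φ (g i) (constWeights lam (SimpleGraph.edge 0 i.succ))
      have h' := hc i (hcard i)
      change _ = ∑ X ∈ A i, sampleProb n (SimpleGraph.edge 0 i.succ) _ X at h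
      change errorProb φ (g i) _ < _ at h'
      linarith
    have h2 := sq_sum_le_card_mul_sum_sq (s := A i) (f := sampleProb n (SimpleGraph.edge 0 i.succ)
      (constWeights lam (SimpleGraph.edge 0 i.succ)))
    have h3 := (Finset.sum_le_univ_sum_of_nonneg (s := A i) fun X ↦ sq_nonneg
      (sampleProb n (SimpleGraph.edge 0 i.succ)
      (constWeights lam (SimpleGraph.edge 0 i.succ)) X)).trans
      (sum_sq_sampleProb_edge_le n lam (hne i))
    -- Cauchy–Schwarz on `A i`; the `4` in `hn` cancels this `(1 / 2) ^ 2`.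
    have h4 : (1 / 2 : ℝ) ^ 2 < (A i).card * (Real.exp (n * lam ^ 2) / M) :=
      (pow_lt_pow_left₀ h1 (by norm_num) two_ne_zero).trans_le
        (h2.trans (mul_le_mul_of_nonneg_left h3 (Nat.cast_nonneg _)))
    have hm' : (0 : ℝ) < m := by exact_mod_cast hm
    rw [← mul_div_assoc, lt_div_iff₀ hM0] at h4
    rw [div_lt_iff₀ hm']
    have h5 := mul_le_mul_of_nonneg_left hn (Nat.cast_nonneg (α := ℝ) (A i).card)
    linarith
  have : Nonempty (Fin m) := ⟨⟨0, hm⟩⟩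
  have h6 := Finset.sum_lt_sum_of_nonempty (Finset.univ_nonempty (α := Fin m)) fun i _ ↦ hbig i
  rw [Finset.sum_const, Finset.card_univ, Fintype.card_fin, nsmul_eq_mul, mul_div_cancel₀] at h6
  · linarith
  · exact_mod_cast hm.ne'

/-- A sample size of order `max {k, lam ^ (-2)} * log p` is necessary. -/
theorem necessity (a b : ℝ) (ha : 0 < a) :
    ∃ c' : ℝ, 0 < c' ∧ ∃ p₀ : ℕ,
      ∀ (n p k : ℕ) (lam om : ℝ), p₀ ≤ p → 1 ≤ k →
        a / Real.sqrt k ≤ lam → lam ≤ b / Real.sqrt k → lam ≤ om →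
        (n : ℝ) ≤ c' * max (k : ℝ) (lam ^ 2)⁻¹ * Real.log p →
        ∃ θ : SimpleGraph (Fin p) → Weights p,
          ∀ φ : Decoder n p k, ∃ G : GraphClass p k, θ G.1 ∈ paramSet lam om G.1 ∧
            1 / 2 ≤ errorProb φ G (θ G.1) := by
  set B := max (b ^ 2) 1 with hB
  have hB0 : 0 < B := lt_of_lt_of_le one_pos (le_max_right _ _)
  -- The constant gives `exp (n * lam ^ 2) ≤ √p`, and `4 * √p ≤ p - 1` once `p ≥ 20`.
  refine ⟨1 / (2 * B), by positivity, 20, fun n p k lam om hp hk hal hlb hlo hn ↦ ?_⟩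
  refine ⟨constWeights lam, fun φ ↦ ?_⟩
  have hk0 : (0 : ℝ) < k := by exact_mod_cast hk
  have hs0 : 0 < √(k : ℝ) := Real.sqrt_pos.2 hk0
  have hl0 : 0 < lam := lt_of_lt_of_le (by positivity) hal
  have hkl : k * lam ^ 2 ≤ b ^ 2 := by
    have := pow_le_pow_left₀ hl0.le hlb 2
    rw [div_pow, Real.sq_sqrt hk0.le, le_div_iff₀ hk0] at this
    linarith
  obtain ⟨m, rfl⟩ : ∃ m, p = m + 1 := ⟨p - 1, by omega⟩
  have hlogp : 0 ≤ Real.log ((m + 1 : ℕ) : ℝ) := Real.log_natCast_nonneg _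
  have hmax : max (k : ℝ) (lam ^ 2)⁻¹ * lam ^ 2 ≤ B := by
    rw [max_mul_of_nonneg _ _ (sq_nonneg _), inv_mul_cancel₀ (by positivity)]
    exact max_le_max hkl le_rfl
  have hexp : n * lam ^ 2 ≤ Real.log ((m + 1 : ℕ) : ℝ) / 2 := by
    calc n * lam ^ 2 ≤ 1 / (2 * B) * max (k : ℝ) (lam ^ 2)⁻¹ * Real.log ((m + 1 : ℕ) : ℝ) *
          lam ^ 2 := by gcongr
      _ = 1 / (2 * B) * Real.log ((m + 1 : ℕ) : ℝ) * (max (k : ℝ) (lam ^ 2)⁻¹ * lam ^ 2) := by ring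
      _ ≤ 1 / (2 * B) * Real.log ((m + 1 : ℕ) : ℝ) * B := by gcongr
      _ = _ := by field_simp
  have hmR : (19 : ℝ) ≤ m := by exact_mod_cast (by omega : 19 ≤ m)
  have h4 : 4 * Real.exp (n * lam ^ 2) ≤ m := by
    have h1 : Real.exp (n * lam ^ 2) ≤ √(m + 1 : ℝ) := by
      rw [← Real.le_log_iff_exp_le (Real.sqrt_pos.2 (by positivity)), Real.log_sqrt (by positivity)]
      exact_mod_cast hexp
    have h2 : √(m + 1 : ℝ) ≤ m / 4 := Real.sqrt_le_iff.2 ⟨by positivity, by nlinarith⟩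
    linarith
  obtain ⟨i, hi, herr⟩ := exists_half_le_errorProb hk (by omega) h4 φ
  exact ⟨⟨_, hi⟩, constWeights_edge_mem_paramSet hl0.le hlo (Fin.succ_ne_zero i).symm, herr⟩

end IsingSelection

theorem corollary4 (a b : ℝ) (ha : 0 < a) (hab : a ≤ b) :
    -- sufficiency of order k ^ 2 * log p samples, with known edge weights
    (∀ omMax : ℝ, ∃ c : ℝ, 0 < c ∧ ∀ δ : ℝ, 0 < δ → ∃ N : ℕ,
      ∀ (n p k : ℕ) (lam om : ℝ), N ≤ n → 1 ≤ k →
        a / Real.sqrt k ≤ lam → lam ≤ b / Real.sqrt k → 0 < om → om ≤ omMax →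
        c * (k : ℝ) ^ 2 * Real.log p < n →
        ∀ θ : SimpleGraph (Fin p) → IsingSelection.Weights p,
          ∃ φ : IsingSelection.Decoder n p k,
            ∀ G : IsingSelection.GraphClass p k,
              θ G.1 ∈ IsingSelection.paramSet lam om G.1 →
                IsingSelection.errorProb φ G (θ G.1) ≤ δ) ∧
    -- necessity of order max {k, lam ^ (-2)} * log p samples, even with known edge weights
    (∃ c' : ℝ, 0 < c' ∧ ∃ p₀ : ℕ,
      ∀ (n p k : ℕ) (lam om : ℝ), p₀ ≤ p → 1 ≤ k →
        a / Real.sqrt k ≤ lam → lam ≤ b / Real.sqrt k → lam ≤ om →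
        (n : ℝ) ≤ c' * max (k : ℝ) (lam ^ 2)⁻¹ * Real.log p →
        ∃ θ : SimpleGraph (Fin p) → IsingSelection.Weights p,
          ∀ φ : IsingSelection.Decoder n p k,
            ∃ G : IsingSelection.GraphClass p k,
              θ G.1 ∈ IsingSelection.paramSet lam om G.1 ∧
                1 / 2 ≤ IsingSelection.errorProb φ G (θ G.1)) ∧
    -- the two thresholds agree up to a constant times k
    (∀ c c' : ℝ, 0 < c → 0 < c' → ∃ C : ℝ, 0 < C ∧
      ∀ (p k : ℕ) (lam : ℝ), 1 ≤ k →
        a / Real.sqrt k ≤ lam → lam ≤ b / Real.sqrt k →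
        c * (k : ℝ) ^ 2 * Real.log p ≤
          C * (k : ℝ) * (c' * max (k : ℝ) (lam ^ 2)⁻¹ * Real.log p)) := by

  refine ⟨fun omMax ↦ IsingSelection.sufficiency a b omMax ha, IsingSelection.necessity a b ha,
    fun c c' hc hc' ↦ ⟨c / c', by positivity, fun p k lam _ _ _ ↦ ?_⟩⟩
  have hlog : 0 ≤ Real.log (p : ℝ) := Real.log_natCast_nonneg p
  calc c * (k : ℝ) ^ 2 * Real.log p = c * k * (k * Real.log p) := by ring
    _ ≤ c * k * (max (k : ℝ) (lam ^ 2)⁻¹ * Real.log p) := by gcongr; exact le_max_left _ _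
    _ = c / c' * k * (c' * max (k : ℝ) (lam ^ 2)⁻¹ * Real.log p) := by field_simp
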